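/- Let $M\in\mathbb N$, let $D>0$, and put $k=2\pi/D$. Let $A$ be the real symmetric tridiagonal $(M+1)\times(M+1)$ matrix, with rows and columns indexed by $0,\dots,M$, whose diagonal is zero and whose entries $A_{j-1,j}=A_{j,j-1}$ equal $\sqrt{j}$ for $1\le j\le M$. Let $H=\mathrm{diag}(h_0,\dots,h_M)$ be a real diagonal matrix with $h_j\le 0$ for all $j$, $h_0=0$ and $h_M\ne 0$. For $m\in\mathbb Z\setminus\{0\}$ let $$A_m=-\mathrm{i}\,mk\,A+H .$$ Then the following hold, where $\|\cdot\|$ denotes the Euclidean norm of vectors and the induced operator norm of matrices. 1. There is a constant $C^{(0)}>0$ (depending only on $M$, $D$ and $H$) such that for every $m\in\mathbb Z\setminus\{0\}$ and every decomposition $A_m=R_mJ_mR_m^{-1}$, where $J_m$ is a matrix in Jordan normal form (with ones on the superdiagonal inside the Jordan blocks) and $R_m$ is an invertible complex matrix all of whose columns are unit vectors, one has $$\|R_m\|\le C^{(0)},\qquad \|R_m^{-1}\|\le C^{(0)} .$$ 2. There is a constant $\lambda^{(0)}>0$ (depending only on $M$, $D$ and $H$) such that for every $m\in\mathbb Z\setminus\{0\}$,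 every eigenvalue of $A_m$ has real part less than $-\lambda^{(0)}$. -/

import Mathlib

open scoped Matrix.Norms.L2Operator

/-- The symmetric tridiagonal `(M+1) × (M+1)` matrix with zero diagonal and off-diagonal entries
`√1, √2, …, √M` (multiplication by the velocity in the normalized Hermite basis). -/
noncomputable def hermiteMatrix (M : ℕ) : Matrix (Fin (M + 1)) (Fin (M + 1)) ℝ :=
  Matrix.of fun i j =>
    if (i : ℕ) + 1 = (j : ℕ) then Real.sqrt (j : ℕ)
    else if (j : ℕ) + 1 = (i : ℕ) then Real.sqrt (i : ℕ)
    else 0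

/-- The matrix `A_m = -i m k A + H` of the `m`-th Fourier mode for the spatial period `D`, where
`k = 2π / D`, `A` is the Hermite matrix and `H = diag (h_0, …, h_M)` is the filter. -/
noncomputable def modeMatrix (M : ℕ) (D : ℝ) (h : Fin (M + 1) → ℝ) (m : ℤ) :
    Matrix (Fin (M + 1)) (Fin (M + 1)) ℂ :=
  (-(Complex.I * (m : ℂ) * ((2 * Real.pi / D : ℝ) : ℂ))) •
      (hermiteMatrix M).map (fun x : ℝ => (x : ℂ))
    + Matrix.diagonal (fun i => (h i : ℂ))

/-- `J` is a matrix in Jordan normal form, that is, a block diagonal matrix whose consecutive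
diagonal blocks are Jordan blocks: all entries off the diagonal and the first superdiagonal vanish,
a superdiagonal entry is `1` inside a block, where the two neighbouring diagonal entries agree,
and `0` between two blocks. -/
structure IsJordanNormalForm {n : ℕ} (J : Matrix (Fin n) (Fin n) ℂ) : Prop where
  eq_zero : ∀ i j : Fin n, j ≠ i → (j : ℕ) ≠ (i : ℕ) + 1 → J i j = 0
  superdiag : ∀ i j : Fin n, (j : ℕ) = (i : ℕ) + 1 → J i j = 0 ∨ (J i j = 1 ∧ J i i = J j j)

/-- `B = R J R⁻¹` is a Jordan decomposition of `B` in which every column of the invertible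
matrix `R` is a unit vector for the Euclidean norm. -/
structure IsUnitJordanDecomposition {n : ℕ} (B R J : Matrix (Fin n) (Fin n) ℂ) : Prop where
  jordan : IsJordanNormalForm J
  isUnit : IsUnit R
  decomposition : B = R * J * R⁻¹
  unit_columns : ∀ j : Fin n, ‖WithLp.toLp 2 (fun i : Fin n => R i j)‖ = 1

/-! Dividing by `m` turns `A_m` into the pencil `P(s) = -i k A + s H` at `s = 1/m`, so all modes
live over the compact interval `[-1, 1]`, with `s = 0` as the limit of high frequencies. Since the
off-diagonal entries of `A` never vanish, an eigenvector of `P(s)` has nonzero last coordinate and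
eigenspaces are lines.

Spectral gap: a unit eigenvector `v` of `A_m` satisfies `Re μ = ∑ h_i |v_i|²`, because `A` is
Hermitian. This is negative as `v_M ≠ 0` and `h_M < 0`, and compactness of the set of unit
eigenvectors of all `P(s)` makes it uniform.

Jordan bases: unit columns bound `R`, and `R⁻¹ = adj R / det R`, so a lower bound on `|det R|`
suffices. For large `|m|` it follows by compactness at `s = 0`, where `J / m` degenerates to a
diagonal matrix with distinct entries. For each remaining `m` there are finitely many `J`, and
compactness in `R` alone suffices. Both cases rest on `IsJordanLike.det_ne_zero`. -/

/-- The pencil `-i k A + s H`; the mode matrix `A_m` is `m` times its value at `s = 1 / m`. -/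
noncomputable def modePencil (M : ℕ) (D : ℝ) (h : Fin (M + 1) → ℝ) (s : ℝ) :
    Matrix (Fin (M + 1)) (Fin (M + 1)) ℂ :=
  (-(Complex.I * ((2 * Real.pi / D : ℝ) : ℂ))) • (hermiteMatrix M).map (fun x : ℝ => (x : ℂ))
    + Matrix.diagonal (fun i => (s : ℂ) * (h i : ℂ))

/-! ### Rescaling, and simplicity of the eigenspaces of the pencil. -/

theorem modeMatrix_eq_smul_modePencil (M : ℕ) (D : ℝ) (h : Fin (M + 1) → ℝ) {m : ℤ} (hm : m ≠ 0) :
    modeMatrix M D h m = (m : ℂ) • modePencil M D h ((m : ℝ)⁻¹) := by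
  have hm' : (m : ℂ) ≠ 0 := by exact_mod_cast hm
  ext i j
  simp only [modeMatrix, modePencil, Matrix.add_apply, Matrix.smul_apply, smul_eq_mul,
    Matrix.diagonal_apply]
  split_ifs
  · push_cast
    field_simp
  · ring

theorem waveNumber_ne_zero {D : ℝ} (hD : 0 < D) :
    -(Complex.I * ((2 * Real.pi / D : ℝ) : ℂ)) ≠ 0 := by
  have : (2 * Real.pi / D : ℝ) ≠ 0 := by positivity
  simpa [Complex.I_ne_zero] using this

/-- An eigenvector of the pencil is determined by its last coordinate. -/
theorem modePencil_eigenvector_eq_zero {M : ℕ} {D : ℝ} (hD : 0 < D) {h : Fin (M + 1) → ℝ} {s : ℝ}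
    {μ : ℂ} {v : Fin (M + 1) → ℂ} (hv : (modePencil M D h s).mulVec v = μ • v)
    (hlast : v (Fin.last M) = 0) : v = 0 := by
  funext i
  -- Downward induction on the coordinate: once all later coordinates vanish, row `i + 1` of the
  -- eigenvalue equation reduces to a nonzero multiple of `v i`.
  induction' hn : M - (i : ℕ) using Nat.strong_induction_on with n ih generalizing i
  rcases Nat.lt_or_ge (i : ℕ) M with hi | hi
  · have hzero : ∀ j : Fin (M + 1), (i : ℕ) < j → v j = 0 := fun j hj => by
      have := j.isLt
      exact ih (M - j) (by omega) j rfl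
    set r : Fin (M + 1) := ⟨i + 1, by omega⟩ with hr
    have hrow := congrFun hv r
    rw [Pi.smul_apply, hzero r (show (i : ℕ) < i + 1 from Nat.lt_succ_self _), smul_zero] at hrow
    have hsum : (modePencil M D h s).mulVec v r = modePencil M D h s r i * v i := by
      refine Finset.sum_eq_single (M := ℂ) i (fun j _ hj => ?_) (fun hi' => absurd (Finset.mem_univ i) hi')
      rcases Nat.lt_or_ge (i : ℕ) j with h1 | h1
      · simp [hzero j h1]
      · have h2 : (j : ℕ) ≠ i := fun e => hj (Fin.ext e)
        have h3 : r ≠ j := fun e => by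
          have := congrArg Fin.val e
          simp only [hr] at this
          omega
        have h4 : ¬ ((r : ℕ) + 1 = j) := by simp only [hr]; omega
        have h5 : ¬ ((j : ℕ) + 1 = r) := by simp only [hr]; omega
        simp [modePencil, hermiteMatrix, Matrix.diagonal_apply_ne _ h3, h4, h5]
    rw [hsum] at hrow
    refine (mul_eq_zero.1 hrow).resolve_left ?_
    have h3 : r ≠ i := fun e => by
      have := congrArg Fin.val e
      simp [hr] at this
    have h4 : ¬ ((r : ℕ) + 1 = i) := by simp only [hr]; omega
    have h5 : ((i : ℕ) + 1 = r) := by simp only [hr]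
    have h6 : Real.sqrt (r : ℕ) ≠ 0 := by
      have : 0 < ((r : ℕ) : ℝ) := by
        rw [← h5]
        positivity
      positivity
    have h7 : modePencil M D h s r i
        = -(Complex.I * ((2 * Real.pi / D : ℝ) : ℂ)) * (Real.sqrt (r : ℕ) : ℂ) := by
      simp only [modePencil, hermiteMatrix, Matrix.add_apply, Matrix.smul_apply, Matrix.map_apply,
        Matrix.of_apply, if_neg h4, if_pos h5, Matrix.diagonal_apply_ne _ h3, smul_eq_mul, add_zero]
    rw [h7]
    exact mul_ne_zero (waveNumber_ne_zero hD) (by exact_mod_cast h6)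
  · have : i = Fin.last M := Fin.ext (by have := i.isLt; simp; omega)
    simpa [this] using hlast

/-- Eigenspaces of the pencil are at most one-dimensional. -/
theorem modePencil_eigenvector_smul {M : ℕ} {D : ℝ} (hD : 0 < D) {h : Fin (M + 1) → ℝ} {s : ℝ}
    {μ : ℂ} {v w : Fin (M + 1) → ℂ} (hv : (modePencil M D h s).mulVec v = μ • v)
    (hw : (modePencil M D h s).mulVec w = μ • w) (hv0 : v ≠ 0) :
    ∃ c : ℂ, w = c • v := by
  have h0 : v (Fin.last M) ≠ 0 := fun e => hv0 (modePencil_eigenvector_eq_zero hD hv e)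
  refine ⟨w (Fin.last M) / v (Fin.last M), ?_⟩
  rw [← sub_eq_zero]
  refine modePencil_eigenvector_eq_zero (μ := μ) (s := s) (h := h) hD ?_ ?_
  · rw [Matrix.mulVec_sub, Matrix.mulVec_smul, hv, hw, smul_sub, smul_comm]
  · simp [h0]

/-! ### Intertwiners with Jordan-like matrices. -/

section Bidiagonal

open Matrix

variable {n : ℕ}

/-- Upper bidiagonal matrices that, like Jordan matrices, have equal diagonal entries next to each
nonzero superdiagonal entry. -/
structure IsJordanLike (L : Matrix (Fin n) (Fin n) ℂ) : Prop where
  eq_zero : ∀ i j : Fin n, j ≠ i → (j : ℕ) ≠ (i : ℕ) + 1 → L i j = 0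
  superdiag : ∀ i j : Fin n, (j : ℕ) = (i : ℕ) + 1 → L i j * (L i i - L j j) = 0

/-- Needed for `t = 1/m`: rescaling turns the superdiagonal ones into `t`. -/
theorem IsJordanNormalForm.isJordanLike_smul {J : Matrix (Fin n) (Fin n) ℂ}
    (hJ : IsJordanNormalForm J) (t : ℂ) : IsJordanLike (t • J) where
  eq_zero i j h1 h2 := by simp [hJ.eq_zero i j h1 h2]
  superdiag i j hij := by
    rcases hJ.superdiag i j hij with h | ⟨-, h⟩ <;> simp [h]

/-- Take the first index `b` carrying the value `L a a`: a nonzero entry above `L b b` would force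
the same value at `b - 1`. -/
theorem IsJordanLike.exists_col {L : Matrix (Fin n) (Fin n) ℂ} (hL : IsJordanLike L) (a : Fin n) :
    ∃ b : Fin n, L *ᵥ Pi.single b 1 = L a a • Pi.single b 1 := by
  classical
  have hne : (Finset.univ.filter fun i => L i i = L a a).Nonempty := ⟨a, by simp⟩
  refine ⟨(Finset.univ.filter fun i => L i i = L a a).min' hne, ?_⟩
  set b := (Finset.univ.filter fun i => L i i = L a a).min' hne with hb
  have hbm : L b b = L a a := by
    simpa using Finset.min'_mem _ hne
  have hmin : ∀ i, L i i = L a a → b ≤ i := fun i hi => Finset.min'_le _ _ (by simpa using hi)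
  rw [mulVec_single_one]
  funext i
  simp only [col_apply, Pi.smul_apply, smul_eq_mul, Pi.single_apply, mul_ite, mul_one, mul_zero]
  split_ifs with hib
  · rw [hib, hbm]
  · by_cases h1 : (b : ℕ) = i + 1
    · rcases mul_eq_zero.1 (hL.superdiag i b h1) with h2 | h2
      · exact h2
      · have := hmin i (by rw [← hbm]; exact sub_eq_zero.1 h2)
        rw [Fin.le_def] at this
        omega
    · exact hL.eq_zero i b (fun e => hib e.symm) h1

theorem IsJordanLike.exists_diag_eq {L : Matrix (Fin n) (Fin n) ℂ} (hL : IsJordanLike L) {μ : ℂ}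
    {x : Fin n → ℂ} (hx0 : x ≠ 0) (hx : L *ᵥ x = μ • x) : ∃ a, L a a = μ := by
  have hdet : (L - scalar (Fin n) μ).det = 0 := by
    rw [← exists_mulVec_eq_zero_iff]
    refine ⟨x, hx0, ?_⟩
    rw [sub_mulVec, hx]
    ext i
    simp [scalar_apply]
  have htri : (L - scalar (Fin n) μ).IsUpperTriangular := by
    intro i j hij
    have hij' : j < i := hij
    have : (j : ℕ) < i := hij'
    rw [Matrix.sub_apply, hL.eq_zero i j (by omega) (by omega)]
    simp [scalar_apply, Matrix.diagonal_apply_ne _ hij'.ne']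
  rw [det_of_isUpperTriangular htri] at hdet
  obtain ⟨a, -, ha⟩ := Finset.prod_eq_zero_iff.1 hdet
  exact ⟨a, by simpa [scalar_apply, sub_eq_zero] using ha⟩

/-- If `T R = R L` with nonzero columns of `R` and at most one-dimensional eigenspaces of the
Jordan-like matrix `L`, then `R` is invertible. -/
theorem IsJordanLike.det_ne_zero {T R L : Matrix (Fin n) (Fin n) ℂ} (hL : IsJordanLike L)
    (hTR : T * R = R * L) (hcol : ∀ j, R *ᵥ Pi.single j 1 ≠ 0)
    (hsimple : ∀ (μ : ℂ) (x y : Fin n → ℂ), L *ᵥ x = μ • x → L *ᵥ y = μ • y → x ≠ 0 →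
      ∃ c : ℂ, y = c • x) : R.det ≠ 0 := by
  intro hdet
  obtain ⟨v, hv0, hv⟩ := exists_mulVec_eq_zero_iff.2 hdet
  -- The kernel of `R` is `L`-invariant, so if nonzero it contains an eigenvector `x` of `L`. By
  -- simplicity `x` spans the line of some basis vector, and the corresponding column of `R` would
  -- vanish.
  have hinv : ∀ x ∈ LinearMap.ker (toLin' R), toLin' L x ∈ LinearMap.ker (toLin' R) := by
    intro x hx
    rw [LinearMap.mem_ker, toLin'_apply] at hx ⊢
    rw [toLin'_apply, mulVec_mulVec, ← hTR, ← mulVec_mulVec, hx, mulVec_zero]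
  have : Nontrivial (LinearMap.ker (toLin' R)) :=
    ⟨⟨⟨v, by simpa using hv⟩, 0, fun e => hv0 (congrArg Subtype.val e)⟩⟩
  obtain ⟨μ, hμ⟩ := Module.End.exists_eigenvalue ((toLin' L).restrict hinv)
  obtain ⟨⟨x, hxk⟩, hx⟩ := hμ.exists_hasEigenvector
  have hLx : L *ᵥ x = μ • x := by
    simpa using congrArg Subtype.val hx.apply_eq_smul
  have hx0 : x ≠ 0 := fun e => hx.2 (Subtype.ext e)
  obtain ⟨a, rfl⟩ := hL.exists_diag_eq hx0 hLx
  obtain ⟨b, hb⟩ := hL.exists_col a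
  obtain ⟨c, hc⟩ := hsimple _ _ _ hLx hb hx0
  refine hcol b ?_
  rw [hc, mulVec_smul, show R *ᵥ x = 0 by simpa using hxk, smul_zero]

end Bidiagonal

/-! ### Real parts of eigenvalues, and the simple spectrum at `s = 0`. -/

section Spectrum

open Matrix

theorem isHermitian_hermiteMatrix (M : ℕ) :
    ((hermiteMatrix M).map (fun x : ℝ => (x : ℂ))).IsHermitian := by
  ext i j
  rw [conjTranspose_apply, map_apply, map_apply, RCLike.star_def, Complex.conj_ofReal]
  congr 1
  simp only [hermiteMatrix, of_apply]
  split_ifs <;> first | rfl | omega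

/-- Pair the eigenvalue equation with `v`: the Hermitian part `A` contributes a purely imaginary
term. -/
theorem re_eigenvalue_modeMatrix {M : ℕ} {D : ℝ} {h : Fin (M + 1) → ℝ} {m : ℤ} {μ : ℂ}
    {v : Fin (M + 1) → ℂ} (hv : modeMatrix M D h m *ᵥ v = μ • v) (hunit : ∑ i, ‖v i‖ ^ 2 = 1) :
    μ.re = ∑ i, h i * ‖v i‖ ^ 2 := by
  have hsq : ∀ z : ℂ, star z * z = ((‖z‖ ^ 2 : ℝ) : ℂ) := fun z => by
    rw [RCLike.star_def, Complex.conj_mul', Complex.ofReal_pow]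
  have h1 : star v ⬝ᵥ (modeMatrix M D h m *ᵥ v) = μ := by
    rw [hv, dotProduct_smul, smul_eq_mul]
    have : star v ⬝ᵥ v = ((∑ i, ‖v i‖ ^ 2 : ℝ) : ℂ) := by
      simp only [dotProduct, Pi.star_apply, hsq]
      push_cast
      rfl
    rw [this, hunit]
    simp
  have h2 : star v ⬝ᵥ (diagonal (fun i => (h i : ℂ)) *ᵥ v)
      = ((∑ i, h i * ‖v i‖ ^ 2 : ℝ) : ℂ) := by
    rw [dotProduct, Complex.ofReal_sum]
    refine Finset.sum_congr rfl fun i _ => ?_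
    rw [mulVec_diagonal, Pi.star_apply, Complex.ofReal_mul, ← hsq]
    ring
  have h3 := (isHermitian_hermiteMatrix M).im_star_dotProduct_mulVec_self v
  rw [modeMatrix, add_mulVec, dotProduct_add, h2, smul_mulVec, dotProduct_smul] at h1
  have h4 := congrArg Complex.re h1
  simp only [RCLike.im_to_complex] at h3
  simpa [h3, ← Complex.ofReal_pow] using h4.symm

/-- Orthonormal eigenvectors of `A` with equal eigenvalues would be proportional, so the spectrum is
simple. The hypothesis is a pointwise identity of determinants because that form passes to limits.
-/
theorem injective_diag_of_charpoly_modePencil_zero {M : ℕ} {D : ℝ} (hD : 0 < D)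
    {h : Fin (M + 1) → ℝ} {l : Fin (M + 1) → ℂ}
    (hdet : ∀ z : ℂ, (scalar _ z - modePencil M D h 0).det = (scalar _ z - diagonal l).det) :
    Function.Injective l := by
  set c : ℂ := -(Complex.I * ((2 * Real.pi / D : ℝ) : ℂ)) with hc
  have hc0 : c ≠ 0 := waveNumber_ne_zero hD
  set A := (hermiteMatrix M).map (fun x : ℝ => (x : ℂ)) with hAdef
  have hA : A.IsHermitian := isHermitian_hermiteMatrix M
  have hP : modePencil M D h 0 = c • A := by
    simp [modePencil, hc, hAdef]
  have hinj : Function.Injective hA.eigenvalues := by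
    intro i j hij
    by_contra hne
    have heig : ∀ t, modePencil M D h 0 *ᵥ (hA.eigenvectorBasis t : Fin (M + 1) → ℂ)
        = (c * (hA.eigenvalues t : ℂ)) • (hA.eigenvectorBasis t : Fin (M + 1) → ℂ) := fun t => by
      rw [hP, smul_mulVec, hA.mulVec_eigenvectorBasis, mul_smul]
      rfl
    have hi0 : (hA.eigenvectorBasis i : Fin (M + 1) → ℂ) ≠ 0 := fun e => by
      have := hA.eigenvectorBasis.orthonormal.ne_zero i
      exact this (by ext t; exact congrFun e t)
    obtain ⟨d, hd⟩ := modePencil_eigenvector_smul hD (heig i) (hij ▸ heig j) hi0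
    have hd' : hA.eigenvectorBasis j = d • hA.eigenvectorBasis i := by
      ext t
      exact congrFun hd t
    have h1 := hA.eigenvectorBasis.orthonormal.2 hne
    have h2 := hA.eigenvectorBasis.orthonormal.1 i
    simp only at h1
    rw [hd', inner_smul_right, inner_self_eq_norm_sq_to_K, h2] at h1
    have hd0 : d = 0 := by simpa using h1
    exact hA.eigenvectorBasis.orthonormal.ne_zero j (by rw [hd', hd0, zero_smul])
  have hchar : (diagonal fun i => l i / c).charpoly = A.charpoly := by
    refine Polynomial.funext fun z => ?_
    rw [eval_charpoly, eval_charpoly]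
    have hcn : c ^ Fintype.card (Fin (M + 1)) ≠ 0 := pow_ne_zero _ hc0
    refine mul_left_cancel₀ hcn ?_
    rw [← det_smul, ← det_smul, smul_sub, smul_sub, ← hP]
    have hs : c • scalar (Fin (M + 1)) z = scalar (Fin (M + 1)) (c * z) := by
      ext i j
      simp [scalar_apply, diagonal_apply]
    have hl : c • diagonal (fun i => l i / c) = diagonal l := by
      ext i j
      by_cases hij : i = j
      · subst hij
        simp [mul_div_cancel₀ _ hc0]
      · simp [hij]
    rw [hs, hl, hdet]
  have hnodup : (Multiset.map (fun i => l i / c) Finset.univ.val).Nodup := by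
    have hroots := congrArg Polynomial.roots hchar
    rw [hA.roots_charpoly_eq_eigenvalues, charpoly_diagonal, Polynomial.roots_prod _ _
      (by simp [Finset.prod_ne_zero_iff, Polynomial.X_sub_C_ne_zero])] at hroots
    simp only [Polynomial.roots_X_sub_C, Multiset.bind_singleton] at hroots
    rw [hroots]
    exact Finset.univ.nodup.map (Complex.ofReal_injective.comp hinj)
  intro i j hij
  exact Multiset.inj_on_of_nodup_map hnodup i (Finset.mem_univ i) j (Finset.mem_univ j)
    (congrArg (· / c) hij)

end Spectrum

/-! ### Compact sets of matrices and eigenvalue bounds. -/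

section Compactness

open Matrix

theorem isCompact_setOf_norm_entry_le (n : ℕ) (C : ℝ) :
    IsCompact {R : Matrix (Fin n) (Fin n) ℂ | ∀ i j, ‖R i j‖ ≤ C} := by
  have e : {R : Matrix (Fin n) (Fin n) ℂ | ∀ i j, ‖R i j‖ ≤ C} =
      Set.univ.pi fun _ : Fin n => Set.univ.pi fun _ : Fin n => Metric.closedBall (0 : ℂ) C :=
    Set.ext fun R => by
      change _ ↔ ∀ i ∈ Set.univ, ∀ j ∈ Set.univ, R i j ∈ Metric.closedBall (0 : ℂ) C
      simp
  rw [e]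
  exact isCompact_univ_pi fun _ => isCompact_univ_pi fun _ => isCompact_closedBall _ _

/-- Matrices with columns of Euclidean norm one. -/
def unitColumns (n : ℕ) : Set (Matrix (Fin n) (Fin n) ℂ) := {R | ∀ j, ∑ i, ‖R i j‖ ^ 2 = 1}

theorem norm_le_one_of_sum_sq_eq_one {n : ℕ} {v : Fin n → ℂ} (hv : ∑ i, ‖v i‖ ^ 2 = 1)
    (i : Fin n) : ‖v i‖ ≤ 1 := by
  have : ‖v i‖ ^ 2 ≤ ∑ i, ‖v i‖ ^ 2 :=
    Finset.single_le_sum (f := fun i => ‖v i‖ ^ 2) (fun _ _ => by positivity) (Finset.mem_univ i)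
  nlinarith [norm_nonneg (v i)]

theorem isClosed_unitColumns (n : ℕ) : IsClosed (unitColumns n) := by
  simp only [unitColumns, Set.ofPred_forall]
  exact isClosed_iInter fun j => isClosed_eq (by fun_prop) continuous_const

theorem isCompact_unitColumns (n : ℕ) : IsCompact (unitColumns n) :=
  (isCompact_setOf_norm_entry_le n 1).of_isClosed_subset (isClosed_unitColumns n)
    fun _ hR i j => norm_le_one_of_sum_sq_eq_one (hR j) i

theorem mulVec_single_ne_zero_of_mem_unitColumns {n : ℕ} {R : Matrix (Fin n) (Fin n) ℂ}
    (hR : R ∈ unitColumns n) (j : Fin n) : R *ᵥ Pi.single j 1 ≠ 0 := by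
  intro e
  have h1 := hR j
  have h2 : ∀ i, R i j = 0 := fun i => by
    have := congrFun e i
    rwa [mulVec_single_one] at this
  simp [h2] at h1

theorem exists_norm_mulVec_eigenvalue_le (M : ℕ) (D : ℝ) (h : Fin (M + 1) → ℝ) :
    ∃ C : ℝ, ∀ s ∈ Set.Icc (-1 : ℝ) 1, ∀ (μ : ℂ) (v : Fin (M + 1) → ℂ), v ≠ 0 →
      modePencil M D h s *ᵥ v = μ • v → ‖μ‖ ≤ C := by
  have hcont : Continuous (modePencil M D h) := by
    unfold modePencil
    fun_prop
  obtain ⟨C, hC⟩ := (isCompact_Icc (a := (-1 : ℝ)) (b := 1)).exists_bound_of_continuousOn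
    hcont.continuousOn
  refine ⟨C, fun s hs μ v hv0 hv => ?_⟩
  have h1 := l2_opNorm_mulVec (modePencil M D h s) (WithLp.toLp 2 v)
  have h2 : WithLp.toLp 2 (modePencil M D h s *ᵥ v) = μ • WithLp.toLp 2 v := by
    rw [hv]
    rfl
  have h3 : 0 < ‖WithLp.toLp 2 v‖ := norm_pos_iff.2 (by simpa using hv0)
  have h4 : ‖μ‖ * ‖WithLp.toLp 2 v‖ ≤ C * ‖WithLp.toLp 2 v‖ := by
    rw [← norm_smul, ← h2]
    exact h1.trans (mul_le_mul_of_nonneg_right (hC s hs) h3.le)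
  exact le_of_mul_le_mul_right h4 h3

end Compactness

/-! ### Determinant bounds and the spectral gap. -/

section MainProof

open Matrix

theorem IsUnitJordanDecomposition.mem_unitColumns {n : ℕ} {B R J : Matrix (Fin n) (Fin n) ℂ}
    (hd : IsUnitJordanDecomposition B R J) : R ∈ unitColumns n := by
  intro j
  have h1 := hd.unit_columns j
  rw [EuclideanSpace.norm_eq, Real.sqrt_eq_one] at h1
  exact h1

theorem IsUnitJordanDecomposition.mul_eq {n : ℕ} {B R J : Matrix (Fin n) (Fin n) ℂ}
    (hd : IsUnitJordanDecomposition B R J) : B * R = R * J := by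
  have hdet := (isUnit_iff_isUnit_det R).1 hd.isUnit
  conv_lhs => rw [hd.decomposition]
  rw [Matrix.mul_assoc, nonsing_inv_mul _ hdet, Matrix.mul_one]

theorem modePencil_mul_eq {M : ℕ} {D : ℝ} {h : Fin (M + 1) → ℝ} {m : ℤ} (hm : m ≠ 0)
    {R J : Matrix (Fin (M + 1)) (Fin (M + 1)) ℂ}
    (hd : IsUnitJordanDecomposition (modeMatrix M D h m) R J) :
    modePencil M D h ((m : ℝ)⁻¹) * R = R * ((m : ℂ)⁻¹ • J) := by
  have hm' : (m : ℂ) ≠ 0 := by exact_mod_cast hm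
  have h1 := hd.mul_eq
  rw [modeMatrix_eq_smul_modePencil M D h hm, smul_mul] at h1
  rw [Matrix.mul_smul, ← h1, smul_smul, inv_mul_cancel₀ hm', one_smul]

theorem det_scalar_sub_eq_of_mul_eq {n : ℕ} {T R L : Matrix (Fin n) (Fin n) ℂ} (hR : R.det ≠ 0)
    (hTR : T * R = R * L) (z : ℂ) : (scalar _ z - T).det = (scalar _ z - L).det := by
  have : (scalar _ z - T) * R = R * (scalar _ z - L) := by
    rw [sub_mul, mul_sub, hTR, (scalar_commute z (fun r => mul_comm _ r) R).eq]
  have h2 := congrArg det this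
  rw [det_mul, det_mul, mul_comm] at h2
  exact mul_left_cancel₀ hR h2

theorem mulVec_eigenvector_of_mul_eq {n : ℕ} {T R L : Matrix (Fin n) (Fin n) ℂ}
    (hTR : T * R = R * L) {μ : ℂ} {x : Fin n → ℂ} (hx : L *ᵥ x = μ • x) :
    T *ᵥ (R *ᵥ x) = μ • (R *ᵥ x) := by
  rw [mulVec_mulVec, hTR, ← mulVec_mulVec, hx, mulVec_smul]

theorem IsJordanLike.exists_eigenvector {n : ℕ} {T R L : Matrix (Fin n) (Fin n) ℂ}
    (hL : IsJordanLike L) (hTR : T * R = R * L) (hR : R ∈ unitColumns n) (a : Fin n) :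
    ∃ v : Fin n → ℂ, v ≠ 0 ∧ T *ᵥ v = L a a • v := by
  obtain ⟨b, hb⟩ := hL.exists_col a
  exact ⟨_, mulVec_single_ne_zero_of_mem_unitColumns hR b, mulVec_eigenvector_of_mul_eq hTR hb⟩

theorem inv_intCast_mem_Icc {m : ℤ} (hm : m ≠ 0) : ((m : ℝ)⁻¹) ∈ Set.Icc (-1 : ℝ) 1 := by
  refine abs_le.1 ?_
  rw [abs_inv]
  refine inv_le_one_of_one_le₀ ?_
  exact_mod_cast Int.one_le_abs hm

theorem exists_pos_forall_le_of_finite {α : Type*} {S : Set α} (hS : S.Finite) {f : α → ℝ}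
    (hf : ∀ a ∈ S, 0 < f a) : ∃ ε : ℝ, 0 < ε ∧ ∀ a ∈ S, ε ≤ f a := by
  rcases S.eq_empty_or_nonempty with rfl | hne
  · exact ⟨1, one_pos, by simp⟩
  · obtain ⟨a, ha, hmin⟩ := hS.exists_minimalFor f S hne
    exact ⟨f a, hf a ha, fun b hb => (le_total (f a) (f b)).elim id (hmin hb)⟩

theorem exists_det_bound_of_large (M : ℕ) {D : ℝ} (hD : 0 < D) (h : Fin (M + 1) → ℝ) :
    ∃ δ : ℝ, 0 < δ ∧ ∀ m : ℤ, m ≠ 0 → |(m : ℝ)⁻¹| < δ →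
      ∀ R J : Matrix (Fin (M + 1)) (Fin (M + 1)) ℂ,
        IsUnitJordanDecomposition (modeMatrix M D h m) R J → δ ≤ ‖R.det‖ := by
  obtain ⟨C, hC⟩ := exists_norm_mulVec_eigenvalue_le M D h
  -- `C` bounds the diagonal entries of `J / m`, which are eigenvalues of the pencil; `1` bounds its
  -- superdiagonal entries `0` or `1/m`.
  let K : Set (ℝ × Matrix (Fin (M + 1)) (Fin (M + 1)) ℂ × Matrix (Fin (M + 1)) (Fin (M + 1)) ℂ) := Set.Icc (-1 : ℝ) 1 ×ˢ unitColumns (M + 1) ×ˢ {L | ∀ i j, ‖L i j‖ ≤ max C 1}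
  have hK : IsCompact K := isCompact_Icc.prod
    ((isCompact_unitColumns _).prod (isCompact_setOf_norm_entry_le _ _))
  have hcont : Continuous (modePencil M D h) := by
    unfold modePencil
    fun_prop
  -- Closed relations that survive `s → 0`, unlike invertibility of `R`. The third says that
  -- superdiagonal entries are `0` or `s`, so `L` is diagonal at `s = 0`.
  let F : Set (ℝ × Matrix (Fin (M + 1)) (Fin (M + 1)) ℂ × Matrix (Fin (M + 1)) (Fin (M + 1)) ℂ) := {p | modePencil M D h p.1 * p.2.1 = p.2.1 * p.2.2 ∧
    (∀ i j : Fin (M + 1), j ≠ i → (j : ℕ) ≠ (i : ℕ) + 1 → p.2.2 i j = 0) ∧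
    (∀ i j : Fin (M + 1), (j : ℕ) = (i : ℕ) + 1 → p.2.2 i j * (p.2.2 i j - (p.1 : ℂ)) = 0) ∧
    ∀ z : ℂ, (scalar _ z - modePencil M D h p.1).det = (scalar _ z - p.2.2).det}
  have hF : IsClosed F := by
    simp only [F, Set.ofPred_and, Set.ofPred_forall]
    refine (isClosed_eq (by fun_prop) (by fun_prop)).inter (IsClosed.inter ?_ (IsClosed.inter ?_ ?_))
    · exact isClosed_iInter fun i => isClosed_iInter fun j => isClosed_iInter fun _ =>
        isClosed_iInter fun _ => isClosed_eq (by fun_prop) continuous_const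
    · exact isClosed_iInter fun i => isClosed_iInter fun j => isClosed_iInter fun _ =>
        isClosed_eq (by fun_prop) continuous_const
    · exact isClosed_iInter fun z => isClosed_eq (by fun_prop) (by fun_prop)
  -- The summand `|s|` confines the argument to `s = 0`; for `|s|` below half the resulting bound,
  -- the determinant must supply the other half.
  have hpos : ∀ p ∈ K ∩ F, 0 < |p.1| + ‖p.2.1.det‖ := by
    rintro ⟨s, R, L⟩ ⟨⟨-, hR, -⟩, hTR, hz, hs, hdet⟩
    simp only at hR hTR hz hs hdet ⊢
    rcases eq_or_ne s 0 with rfl | hs0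
    · have hdiag : L = diagonal fun i => L i i := by
        ext i j
        rcases eq_or_ne i j with rfl | hij
        · simp
        · rw [diagonal_apply_ne _ hij]
          by_cases h1 : (j : ℕ) = i + 1
          · simpa using hs i j h1
          · exact hz i j hij.symm h1
      have hinj : Function.Injective fun i => L i i :=
        injective_diag_of_charpoly_modePencil_zero hD (fun z => by rw [hdet z, ← hdiag])
      have hL : IsJordanLike L := ⟨hz, fun i j hij => by
        have hne : i ≠ j := fun e => by subst e; omega
        rw [hdiag, diagonal_apply_ne _ hne, zero_mul]⟩
      have := hL.det_ne_zero hTR (mulVec_single_ne_zero_of_mem_unitColumns hR) ?_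
      · positivity
      · intro μ x y hx hy hx0
        obtain ⟨a, ha⟩ := Function.ne_iff.1 hx0
        have hcoord : ∀ v : Fin (M + 1) → ℂ, L *ᵥ v = μ • v → ∀ i, (L i i - μ) * v i = 0 := by
          intro v hv i
          have := congrFun hv i
          rw [hdiag, mulVec_diagonal, Pi.smul_apply, smul_eq_mul] at this
          rw [sub_mul, this, sub_self]
        have hμ : L a a = μ :=
          sub_eq_zero.1 ((mul_eq_zero.1 (hcoord x hx a)).resolve_right ha)
        have hoff : ∀ v : Fin (M + 1) → ℂ, L *ᵥ v = μ • v → ∀ i, i ≠ a → v i = 0 :=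
          fun v hv i hi => (mul_eq_zero.1 (hcoord v hv i)).resolve_left
            (fun e => hi (hinj ((sub_eq_zero.1 e).trans hμ.symm)))
        refine ⟨y a / x a, funext fun i => ?_⟩
        rcases eq_or_ne i a with rfl | hi
        · have : x i ≠ 0 := ha
          simp [this]
        · simp [hoff x hx i hi, hoff y hy i hi]
    · positivity
  have hcontf : ContinuousOn (fun p : ℝ × Matrix (Fin (M + 1)) (Fin (M + 1)) ℂ × Matrix (Fin (M + 1)) (Fin (M + 1)) ℂ => |p.1| + ‖p.2.1.det‖) (K ∩ F) :=
    Continuous.continuousOn (by fun_prop)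
  obtain ⟨ε, hε, hbd⟩ : ∃ ε : ℝ, 0 < ε ∧ ∀ p ∈ K ∩ F, ε ≤ |p.1| + ‖p.2.1.det‖ :=
    (hK.inter_right hF).exists_forall_le' hcontf hpos
  refine ⟨ε / 2, by positivity, fun m hm hlt R J hd => ?_⟩
  have hTR := modePencil_mul_eq hm hd
  have hL := hd.jordan.isJordanLike_smul (m : ℂ)⁻¹
  have hRdet : R.det ≠ 0 := ((isUnit_iff_isUnit_det R).1 hd.isUnit).ne_zero
  have hmem := inv_intCast_mem_Icc hm
  have hJs : ∀ i j : Fin (M + 1), (j : ℕ) = i + 1 →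
      ((m : ℂ)⁻¹ • J) i j * (((m : ℂ)⁻¹ • J) i j - (m : ℂ)⁻¹) = 0 := by
    intro i j hij
    rcases hd.jordan.superdiag i j hij with h1 | ⟨h1, -⟩ <;> simp [h1]
  have hp : ((m : ℝ)⁻¹, R, (m : ℂ)⁻¹ • J) ∈ K ∩ F := by
    refine ⟨⟨hmem, hd.mem_unitColumns, fun i j => ?_⟩, hTR, hL.eq_zero, fun i j hij => ?_,
      det_scalar_sub_eq_of_mul_eq hRdet hTR⟩
    · change ‖((m : ℂ)⁻¹ • J) i j‖ ≤ max C 1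
      rcases eq_or_ne j i with rfl | hij
      · obtain ⟨v, hv0, hv⟩ := hL.exists_eigenvector hTR hd.mem_unitColumns j
        exact (hC _ hmem _ v hv0 hv).trans (le_max_left _ _)
      · by_cases h1 : (j : ℕ) = i + 1
        · rcases mul_eq_zero.1 (hJs i j h1) with h2 | h2
          · rw [h2]
            simp
          · rw [sub_eq_zero.1 h2]
            refine le_trans ?_ (le_max_right _ _)
            rw [norm_inv, Complex.norm_intCast, ← abs_inv]
            exact abs_le.2 hmem
        · rw [hL.eq_zero i j hij h1]
          simp
    · simpa using hJs i j hij
  have := hbd _ hp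
  simp only at this
  linarith

/-- Diagonal entries are eigenvalues, and all other entries are `0` or `1`. -/
theorem finite_setOf_jordan (M : ℕ) (D : ℝ) (h : Fin (M + 1) → ℝ) (m : ℤ) :
    {J : Matrix (Fin (M + 1)) (Fin (M + 1)) ℂ |
      ∃ R, IsUnitJordanDecomposition (modeMatrix M D h m) R J}.Finite := by
  have hfin : ({μ | Module.End.HasEigenvalue (toLin' (modeMatrix M D h m)) μ} ∪ {0, 1} : Set ℂ).Finite :=
    (Module.End.finite_hasEigenvalue _).union (by simp)
  refine (Set.Finite.pi' fun _ : Fin (M + 1) => Set.Finite.pi' fun _ : Fin (M + 1) => hfin).subset ?_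
  rintro J ⟨R, hd⟩ i j
  have hJ : IsJordanLike J := one_smul ℂ J ▸ hd.jordan.isJordanLike_smul 1
  rcases eq_or_ne j i with rfl | hij
  · obtain ⟨v, hv0, hv⟩ := hJ.exists_eigenvector hd.mul_eq hd.mem_unitColumns j
    exact Or.inl (Module.End.hasEigenvalue_of_hasEigenvector
      (Module.End.hasEigenvector_iff.2 ⟨Module.End.mem_eigenspace_iff.2 (by simpa using hv), hv0⟩))
  · by_cases h1 : (j : ℕ) = i + 1
    · rcases hd.jordan.superdiag i j h1 with h2 | ⟨h2, -⟩ <;> simp [h2]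
    · simp [hJ.eq_zero i j hij h1]

/-- With `J` fixed, the intertwining relation is closed in `R`. One decomposition `R₀` transfers
simplicity of eigenspaces from the pencil to `J / m`, so every unit-column intertwiner is
invertible. -/
theorem exists_det_bound_fixed (M : ℕ) {D : ℝ} (hD : 0 < D) (h : Fin (M + 1) → ℝ) {m : ℤ}
    (hm : m ≠ 0) :
    ∃ δ : ℝ, 0 < δ ∧ ∀ R J : Matrix (Fin (M + 1)) (Fin (M + 1)) ℂ,
        IsUnitJordanDecomposition (modeMatrix M D h m) R J → δ ≤ ‖R.det‖ := by
  have key : ∀ J ∈ {J : Matrix (Fin (M + 1)) (Fin (M + 1)) ℂ |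
      ∃ R, IsUnitJordanDecomposition (modeMatrix M D h m) R J}, ∃ δ : ℝ, 0 < δ ∧
      ∀ R, IsUnitJordanDecomposition (modeMatrix M D h m) R J → δ ≤ ‖R.det‖ := by
    rintro J ⟨R₀, hd₀⟩
    have hJ : IsJordanLike ((m : ℂ)⁻¹ • J) := hd₀.jordan.isJordanLike_smul _
    have hR₀ := (isUnit_iff_isUnit_det R₀).1 hd₀.isUnit
    have hclosed : IsClosed {R : Matrix (Fin (M + 1)) (Fin (M + 1)) ℂ |
        modePencil M D h ((m : ℝ)⁻¹) * R = R * ((m : ℂ)⁻¹ • J)} :=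
      isClosed_eq (by fun_prop) (by fun_prop)
    obtain ⟨δ, hδ, hbd⟩ := ((isCompact_unitColumns (M + 1)).inter_right hclosed).exists_forall_le'
      (f := fun R => ‖R.det‖) (a := 0) (Continuous.continuousOn (by fun_prop)) (by
        rintro R ⟨hR, hTR⟩
        refine norm_pos_iff.2 (hJ.det_ne_zero hTR (mulVec_single_ne_zero_of_mem_unitColumns hR) ?_)
        intro μ x y hx hy hx0
        have hTR₀ := modePencil_mul_eq hm hd₀
        have hback : ∀ v : Fin (M + 1) → ℂ, R₀⁻¹ *ᵥ (R₀ *ᵥ v) = v := fun v => by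
          rw [mulVec_mulVec, nonsing_inv_mul _ hR₀, one_mulVec]
        obtain ⟨c, hc⟩ := modePencil_eigenvector_smul hD (mulVec_eigenvector_of_mul_eq hTR₀ hx)
          (mulVec_eigenvector_of_mul_eq hTR₀ hy)
          (fun e => hx0 (by rw [← hback x, e, mulVec_zero]))
        exact ⟨c, by rw [← hback y, hc, mulVec_smul, hback]⟩)
    exact ⟨δ, hδ, fun R hd => hbd R ⟨hd.mem_unitColumns, modePencil_mul_eq hm hd⟩⟩
  choose! δ hδ hbd using key
  obtain ⟨ε, hε, hle⟩ : ∃ ε : ℝ, 0 < ε ∧ ∀ J ∈ {J : Matrix (Fin (M + 1)) (Fin (M + 1)) ℂ |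
      ∃ R, IsUnitJordanDecomposition (modeMatrix M D h m) R J}, ε ≤ δ J :=
    exists_pos_forall_le_of_finite (finite_setOf_jordan M D h m) hδ
  exact ⟨ε, hε, fun R J hd => (hle J ⟨R, hd⟩).trans (hbd J ⟨R, hd⟩ R hd)⟩

theorem exists_det_bound (M : ℕ) {D : ℝ} (hD : 0 < D) (h : Fin (M + 1) → ℝ) :
    ∃ δ : ℝ, 0 < δ ∧ ∀ m : ℤ, m ≠ 0 → ∀ R J : Matrix (Fin (M + 1)) (Fin (M + 1)) ℂ,
        IsUnitJordanDecomposition (modeMatrix M D h m) R J → δ ≤ ‖R.det‖ := by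
  obtain ⟨δ₀, hδ₀, hlarge⟩ := exists_det_bound_of_large M hD h
  have hfix : ∀ m ∈ {m : ℤ | m ≠ 0 ∧ δ₀ ≤ |(m : ℝ)⁻¹|}, ∃ δ : ℝ, 0 < δ ∧
      ∀ R J : Matrix (Fin (M + 1)) (Fin (M + 1)) ℂ,
        IsUnitJordanDecomposition (modeMatrix M D h m) R J → δ ≤ ‖R.det‖ :=
    fun m hm => exists_det_bound_fixed M hD h hm.1
  choose! δ hδ hbd using hfix
  have hfin : {m : ℤ | m ≠ 0 ∧ δ₀ ≤ |(m : ℝ)⁻¹|}.Finite := by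
    refine (Set.finite_Icc (-⌈δ₀⁻¹⌉) ⌈δ₀⁻¹⌉).subset ?_
    rintro m ⟨hm, hle⟩
    have hm' : 0 < |(m : ℝ)| := by simpa using hm
    rw [abs_inv] at hle
    have h1 : |(m : ℝ)| ≤ δ₀⁻¹ := (le_inv_comm₀ hδ₀ hm').1 hle
    have h2 : |m| ≤ ⌈δ₀⁻¹⌉ := by
      exact_mod_cast h1.trans (Int.le_ceil _)
    exact abs_le.1 h2
  obtain ⟨ε, hε, hle⟩ := exists_pos_forall_le_of_finite hfin hδ
  refine ⟨min ε δ₀, lt_min hε hδ₀, fun m hm R J hd => ?_⟩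
  rcases lt_or_ge |(m : ℝ)⁻¹| δ₀ with hlt | hge
  · exact (min_le_right _ _).trans (hlarge m hm hlt R J hd)
  · exact (min_le_left _ _).trans ((hle m ⟨hm, hge⟩).trans (hbd m ⟨hm, hge⟩ R J hd))

theorem exists_jordan_bound (M : ℕ) {D : ℝ} (hD : 0 < D) (h : Fin (M + 1) → ℝ) :
    ∃ C : ℝ, 0 < C ∧ ∀ m : ℤ, m ≠ 0 → ∀ R J : Matrix (Fin (M + 1)) (Fin (M + 1)) ℂ,
        IsUnitJordanDecomposition (modeMatrix M D h m) R J → ‖R‖ ≤ C ∧ ‖R⁻¹‖ ≤ C := by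
  obtain ⟨δ, hδ, hdet⟩ := exists_det_bound M hD h
  obtain ⟨C₁, hC₁⟩ := (isCompact_unitColumns (M + 1)).exists_bound_of_continuousOn
    (f := fun R => R) continuousOn_id
  obtain ⟨C₂, hC₂⟩ := (isCompact_unitColumns (M + 1)).exists_bound_of_continuousOn
    (f := fun R => R.adjugate) (Continuous.continuousOn (by fun_prop))
  refine ⟨max 1 (max C₁ (δ⁻¹ * C₂)), by positivity, fun m hm R J hd => ⟨?_, ?_⟩⟩
  · exact (hC₁ R hd.mem_unitColumns).trans ((le_max_left _ _).trans (le_max_right _ _))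
  · refine le_trans ?_ ((le_max_right _ _).trans (le_max_right _ _))
    rw [inv_def, Ring.inverse_eq_inv', norm_smul, norm_inv]
    exact mul_le_mul (inv_anti₀ hδ (hdet m hm R J hd)) (hC₂ R hd.mem_unitColumns)
      (norm_nonneg _) (by positivity)

theorem exists_spectral_gap (M : ℕ) {D : ℝ} (hD : 0 < D) (h : Fin (M + 1) → ℝ)
    (h_nonpos : ∀ i, h i ≤ 0) (h_last : h (Fin.last M) ≠ 0) :
    ∃ l : ℝ, 0 < l ∧ ∀ m : ℤ, m ≠ 0 → ∀ μ : ℂ,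
        Module.End.HasEigenvalue (toLin' (modeMatrix M D h m)) μ → μ.re < -l := by
  obtain ⟨C, hC⟩ := exists_norm_mulVec_eigenvalue_le M D h
  have hcont : Continuous (modePencil M D h) := by
    unfold modePencil
    fun_prop
  let K : Set (ℝ × (Fin (M + 1) → ℂ) × ℂ) := Set.Icc (-1 : ℝ) 1 ×ˢ
    (Set.univ.pi fun _ => Metric.closedBall 0 1) ×ˢ Metric.closedBall 0 C
  have hK : IsCompact K := isCompact_Icc.prod
    ((isCompact_univ_pi fun _ => isCompact_closedBall _ _).prod (isCompact_closedBall _ _))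
  let F : Set (ℝ × (Fin (M + 1) → ℂ) × ℂ) := {p | ∑ i, ‖p.2.1 i‖ ^ 2 = 1 ∧ modePencil M D h p.1 *ᵥ p.2.1 = p.2.2 • p.2.1}
  have hF : IsClosed F :=
    (isClosed_eq (by fun_prop) continuous_const).inter (isClosed_eq (by fun_prop) (by fun_prop))
  -- This sum is `-Re μ` for the unscaled `A_m`, hence no factor `1/m` is lost; it stays positive at
  -- `s = 0`.
  obtain ⟨δ, hδ, hbd⟩ : ∃ δ : ℝ, 0 < δ ∧ ∀ p ∈ K ∩ F, δ ≤ ∑ i, -h i * ‖p.2.1 i‖ ^ 2 := by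
    refine (hK.inter_right hF).exists_forall_le' (Continuous.continuousOn (by fun_prop)) ?_
    rintro ⟨s, v, μ⟩ ⟨-, hv1, hv⟩
    simp only at hv1 hv ⊢
    have hlast : v (Fin.last M) ≠ 0 := fun e => by
      simp [modePencil_eigenvector_eq_zero hD hv e] at hv1
    refine Finset.sum_pos' (fun i _ => mul_nonneg (neg_nonneg.2 (h_nonpos i)) (by positivity))
      ⟨Fin.last M, Finset.mem_univ _, mul_pos ?_ (by positivity)⟩
    exact neg_pos.2 (lt_of_le_of_ne (h_nonpos _) h_last)
  -- Halving `δ` makes the inequality strict.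
  refine ⟨δ / 2, by positivity, fun m hm μ hμ => ?_⟩
  obtain ⟨w, hw⟩ := hμ.exists_hasEigenvector
  have hw1 : modeMatrix M D h m *ᵥ w = μ • w := by simpa using hw.apply_eq_smul
  have hpos : 0 < ∑ i, ‖w i‖ ^ 2 := by
    obtain ⟨i, hi⟩ := Function.ne_iff.1 hw.2
    have hi' : w i ≠ 0 := hi
    exact Finset.sum_pos' (fun _ _ => by positivity) ⟨i, Finset.mem_univ _, by positivity⟩
  set r := Real.sqrt (∑ i, ‖w i‖ ^ 2) with hr
  have hr0 : 0 < r := Real.sqrt_pos.2 hpos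
  set v : Fin (M + 1) → ℂ := (r : ℂ)⁻¹ • w with hvdef
  have hv : modeMatrix M D h m *ᵥ v = μ • v := by
    rw [hvdef, mulVec_smul, hw1, smul_comm]
  have hv1 : ∑ i, ‖v i‖ ^ 2 = 1 := by
    have : ∀ i, ‖v i‖ ^ 2 = (r ^ 2)⁻¹ * ‖w i‖ ^ 2 := fun i => by
      simp [hvdef, mul_pow]
    rw [Finset.sum_congr rfl fun i _ => this i, ← Finset.mul_sum, hr, Real.sq_sqrt hpos.le,
      inv_mul_cancel₀ hpos.ne']
  have hm' : (m : ℂ) ≠ 0 := by exact_mod_cast hm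
  have hpv : modePencil M D h ((m : ℝ)⁻¹) *ᵥ v = ((m : ℂ)⁻¹ * μ) • v := by
    rw [modeMatrix_eq_smul_modePencil M D h hm, smul_mulVec] at hv
    rw [mul_smul, ← hv, smul_smul, inv_mul_cancel₀ hm', one_smul]
  have hv0 : v ≠ 0 := fun e => by simp [e] at hv1
  have hmem := inv_intCast_mem_Icc hm
  have := hbd ((m : ℝ)⁻¹, v, (m : ℂ)⁻¹ * μ)
    ⟨⟨hmem, fun i _ => by simpa using norm_le_one_of_sum_sq_eq_one hv1 i,
      by simpa using hC _ hmem _ v hv0 hpv⟩, hv1, hpv⟩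
  have hre := re_eigenvalue_modeMatrix hv hv1
  simp only [neg_mul, Finset.sum_neg_distrib] at this
  linarith

end MainProof

theorem mainTheorem3 (M : ℕ) (D : ℝ) (hD : 0 < D) (h : Fin (M + 1) → ℝ)
    (h_nonpos : ∀ i, h i ≤ 0) (h_first : h 0 = 0) (h_last : h (Fin.last M) ≠ 0) :
    (∃ C : ℝ, 0 < C ∧ ∀ m : ℤ, m ≠ 0 → ∀ R J : Matrix (Fin (M + 1)) (Fin (M + 1)) ℂ,
        IsUnitJordanDecomposition (modeMatrix M D h m) R J → ‖R‖ ≤ C ∧ ‖R⁻¹‖ ≤ C) ∧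
    (∃ l : ℝ, 0 < l ∧ ∀ m : ℤ, m ≠ 0 → ∀ μ : ℂ,
        Module.End.HasEigenvalue (Matrix.toLin' (modeMatrix M D h m)) μ → μ.re < -l) :=
  ⟨exists_jordan_bound M hD h, exists_spectral_gap M hD h h_nonpos h_last⟩
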